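/- Let $J\ge 1$, $\mathbf C=\{1,\dots,J\}$, and let $\mathbb P$ be the space of Borel probability measures on $\mathbb R^d$, with the topology of weak convergence. For $G\in\mathbb P$ and $x=(x_1,\dots,x_J)\in\mathbb R^{Jd}$ (each $x_j\in\mathbb R^d$) let $$q_j(x;G)=P(\{j\}\mid G,x)=\int_{\mathbb R^d}\frac{\exp(x_j'\beta)}{\sum_{l\in\mathbf C}\exp(x_l'\beta)}\,G(d\beta),\qquad q(x;G)=[q_1(x;G),\dots,q_J(x;G)].$$ Let $\Pi$ be a prior (a Borel probability measure) on $\mathbb P$, with prior predictive distribution $H(B)=\int_{\mathbb P} G(B)\,\Pi(dG)$, and let $G_0\in\mathbb P$ belong to the weak support of $\Pi$ (every weak neighbourhood of $G_0$ has positive $\Pi$-mass). Let $\mathcal X\subset\mathbb R^{Jd}$ be compact and $M$ a probability measure with $M(\mathcal X)=1$. Let $(Y_i,X_i)_{i\ge1}$ be i.i.d., where $X_i\sim M$ and, given $X_i=x$, $Y_i=j$ with probability $P_0(\{j\}\mid x)=q_j(x;G_0)$; write $P^\infty_{(G_0,M)}$ for the law of the sequence. Let $\Pi_n$ be the posterior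 distribution given $(Y_1,X_1),\dots,(Y_n,X_n)$, $$\Pi_n(A)=\frac{\int_A\Lambda_n(G)\,\Pi(dG)}{\int_{\mathbb P}\Lambda_n(G)\,\Pi(dG)},\qquad \Lambda_n(G)=\prod_{i=1}^n\frac{q_{Y_i}(X_i;G)}{q_{Y_i}(X_i;G_0)},$$ and let $d(q_1,q_2)=\int_{\mathcal X}|q_1(x)-q_2(x)|\,M(dx)$, where $|\cdot|$ is the Euclidean norm. Suppose that (i) $P_0(\{j\}\mid x)>0$ for every $j\in\mathbf C$ and $x\in\mathcal X$, and (ii) $\int_{\mathbb R^d}|\beta|\,H(d\beta)<\infty$. Then $\Pi$ is consistent at $G_0$: for every $\varepsilon>0$, $$\Pi_n\{G\in\mathbb P: d(q(\cdot;G),q(\cdot;G_0))>\varepsilon\}\longrightarrow 0\quad\text{as } n\to\infty,\qquad P^\infty_{(G_0,M)}\text{-almost surely.}$$ -/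

import Mathlib

open MeasureTheory Filter
open scoped Topology ENNReal

namespace MMNL

/-- The space `ℝ^d` of preference vectors `β` (with the Euclidean norm). -/
abbrev Pref (d : ℕ) : Type := EuclideanSpace ℝ (Fin d)

/-- The space `ℝ^{Jd}` of covariates `x = (x_1, …, x_J)`, each `x_j` in `ℝ^d`. -/
abbrev Cov (J d : ℕ) : Type := Fin J → EuclideanSpace ℝ (Fin d)

/-- The space of mixing distributions on `ℝ^d`.  Mathlib equips it with the topology of weak
convergence and with the sigma-algebra generated by the evaluations `G ↦ G B`, `B` Borel. -/
abbrev Mix (d : ℕ) : Type := ProbabilityMeasure (Pref d)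

noncomputable section

variable {J d : ℕ}

/-- The multinomial logit kernel `k_j(x, β) = exp(x_j'β) / ∑_l exp(x_l'β)`. -/
def logitKernel (x : Cov J d) (j : Fin J) (β : Pref d) : ℝ :=
  Real.exp (inner ℝ (x j) β) / ∑ l : Fin J, Real.exp (inner ℝ (x l) β)

/-- The mixed multinomial logit choice probability
`P({j} | G, x) = ∫ k_j(x, β) G(dβ)`. -/
def choiceProb (G : Mix d) (x : Cov J d) (j : Fin J) : ℝ :=
  ∫ β, logitKernel x j β ∂(G : Measure (Pref d))

/-- The vector of choice probabilities `q(x; G)`, in `ℝ^J` with the Euclidean norm. -/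
def choiceVec (G : Mix d) (x : Cov J d) : EuclideanSpace ℝ (Fin J) :=
  WithLp.toLp 2 (fun j => choiceProb G x j)

/-- The `L₁`-type distance `∫_𝒳 |q₁(x) - q₂(x)| M(dx)`. -/
def choiceDist (M : Measure (Cov J d)) (𝒳 : Set (Cov J d))
    (q₁ q₂ : Cov J d → EuclideanSpace ℝ (Fin J)) : ℝ :=
  ∫ x in 𝒳, ‖q₁ x - q₂ x‖ ∂M

/-- The prior predictive distribution `H(B) = E[G(B)]`, `G` distributed as `Pi`. -/
def priorPredictive (Pi : Measure (Mix d)) : Measure (Pref d) :=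
  Pi.bind (fun G => (G : Measure (Pref d)))

theorem priorPredictive_apply (Pi : Measure (Mix d)) {B : Set (Pref d)} (hB : MeasurableSet B) :
    priorPredictive Pi B = ∫⁻ G, (G : Measure (Pref d)) B ∂Pi :=
  Measure.bind_apply hB measurable_subtype_coe.aemeasurable

/-- The law of one observation `(Y, X)`: `X` has law `M` and, given `X = x`, `Y` equals `j` with
probability `P({j} | G, x)`.  It is the measure with density `(j, x) ↦ P({j} | G, x)` with respect
to the product of the counting measure and `M`. -/
def obsLaw (G : Mix d) (M : Measure (Cov J d)) : Measure (Fin J × Cov J d) :=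
  (Measure.count.prod M).withDensity (fun p => ENNReal.ofReal (choiceProb G p.2 p.1))

theorem logitKernel_nonneg (x : Cov J d) (j : Fin J) (β : Pref d) : 0 ≤ logitKernel x j β := by
  unfold logitKernel; positivity

theorem sum_logitKernel [NeZero J] (x : Cov J d) (β : Pref d) :
    ∑ j : Fin J, logitKernel x j β = 1 := by
  unfold logitKernel
  rw [← Finset.sum_div]
  exact div_self (Finset.sum_pos (fun l _ => Real.exp_pos _) Finset.univ_nonempty).ne'

theorem continuous_logitKernel (j : Fin J) :
    Continuous (fun p : Cov J d × Pref d => logitKernel p.1 j p.2) := by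
  unfold logitKernel
  refine Continuous.div (by fun_prop) (by fun_prop) (fun p => ?_)
  exact (Finset.sum_pos (fun l _ => Real.exp_pos _) ⟨j, Finset.mem_univ j⟩).ne'

theorem integrable_logitKernel [NeZero J] (G : Mix d) (x : Cov J d) (j : Fin J) :
    Integrable (logitKernel x j) (G : Measure (Pref d)) := by
  have hc : Continuous (logitKernel x j) :=
    (continuous_logitKernel j).comp (Continuous.prodMk_right x)
  refine Integrable.of_bound hc.aestronglyMeasurable 1 (Eventually.of_forall fun β => ?_)
  rw [Real.norm_of_nonneg (logitKernel_nonneg x j β), ← sum_logitKernel x β]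
  exact Finset.single_le_sum (f := fun i => logitKernel x i β)
    (fun i _ => logitKernel_nonneg x i β) (Finset.mem_univ j)

theorem sum_choiceProb [NeZero J] (G : Mix d) (x : Cov J d) :
    ∑ j : Fin J, choiceProb G x j = 1 := by
  unfold choiceProb
  rw [← integral_finsetSum _ (fun j _ => integrable_logitKernel G x j)]
  simp [sum_logitKernel]

theorem measurable_choiceProb (G : Mix d) :
    Measurable (fun p : Fin J × Cov J d => choiceProb G p.2 p.1) := by
  refine measurable_from_prod_countable_right (fun j => ?_)
  exact ((continuous_logitKernel j).stronglyMeasurable.integral_prod_right'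
    (ν := (G : Measure (Pref d)))).measurable

instance [NeZero J] (G : Mix d) (M : Measure (Cov J d)) [IsProbabilityMeasure M] :
    IsProbabilityMeasure (obsLaw G M) := by
  constructor
  have hm := (measurable_choiceProb (J := J) G).ennreal_ofReal
  have h0 : ∀ x : Cov J d, ∑ j : Fin J, ENNReal.ofReal (choiceProb G x j) = 1 := fun x => by
    have hn : ∀ j ∈ Finset.univ, 0 ≤ choiceProb G x j :=
      fun j _ => integral_nonneg (logitKernel_nonneg x j)
    rw [← ENNReal.ofReal_sum_of_nonneg hn, sum_choiceProb, ENNReal.ofReal_one]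
  rw [obsLaw, withDensity_apply _ MeasurableSet.univ, Measure.restrict_univ,
    lintegral_prod_symm' _ hm]
  simp [lintegral_count, tsum_fintype, h0]

/-- The law `P^∞_{(G, M)}` of an i.i.d. sequence of observations `(Y_i, X_i)`, on the space of
sequences. -/
def dataLaw [NeZero J] (G : Mix d) (M : Measure (Cov J d)) [IsProbabilityMeasure M] :
    Measure (ℕ → Fin J × Cov J d) :=
  Measure.infinitePi (fun _ : ℕ => obsLaw G M)

/-- The likelihood ratio `Λ_n(G) = ∏_{i ≤ n} q_{Y_i}(X_i; G) / q_{Y_i}(X_i; G₀)` of the first `n`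
observations of the data sequence `ω`. -/
def likelihoodRatio (G₀ : Mix d) (n : ℕ) (ω : ℕ → Fin J × Cov J d) (G : Mix d) : ℝ :=
  ∏ i ∈ Finset.range n, choiceProb G (ω i).2 (ω i).1 / choiceProb G₀ (ω i).2 (ω i).1

/-- The posterior distribution given the first `n` observations,
`Pi_n(A) = ∫_A Λ_n(G) Pi(dG) / ∫ Λ_n(G) Pi(dG)`.  (The factors `q_{Y_i}(X_i; G₀) > 0` cancel, so
that it does not depend on `G₀`.) -/
def posterior (Pi : Measure (Mix d)) (G₀ : Mix d) (n : ℕ) (ω : ℕ → Fin J × Cov J d) :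
    Measure (Mix d) :=
  (∫⁻ G, ENNReal.ofReal (likelihoodRatio G₀ n ω G) ∂Pi)⁻¹ •
    Pi.withDensity (fun G => ENNReal.ofReal (likelihoodRatio G₀ n ω G))

/-- Posterior consistency of the prior `Pi` at `G₀`: for every `ε > 0`, almost surely under
`P^∞_{(G₀, M)}`, the posterior mass of `{G : d(q(·; G), q(·; G₀)) > ε}` tends to zero. -/
def IsConsistentAt [NeZero J] (Pi : Measure (Mix d)) (G₀ : Mix d) (M : Measure (Cov J d))
    [IsProbabilityMeasure M] (𝒳 : Set (Cov J d)) : Prop :=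
  ∀ ε : ℝ, 0 < ε → ∀ᵐ ω ∂(dataLaw G₀ M),
    Tendsto (fun n : ℕ => posterior Pi G₀ n ω
      {G | ε < choiceDist M 𝒳 (choiceVec G) (choiceVec G₀)}) atTop (𝓝 0)

end

end MMNL

/-!
Write `q_j(x; G)` for the choice probabilities and `t = q_j(x; G) / q_j(x; G₀)`. By compactness and
positivity, `q_j(·; G₀) ≥ c > 0` on `𝒳`, so `0 ≤ t ≤ 1/c`, and there
`log t ≤ φ(t) := (t - 1) - (c/4) (t - 1)²`. The function `φ` is Lipschitz on `[0, 1/c]`, and under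
`G₀` the mean of `φ(t)` is at most `-(c/4) d(q(·; G), q(·; G₀))²`, as the linear part integrates to
zero (`integral_chiScore_le`). A strong law for `φ(t)`, uniform over all mixing distributions `G`,
hence bounds the likelihood ratio by `exp (-n a)`, with `a > 0`, simultaneously for all `G` with
`d > ε` (`ae_eventually_likelihoodRatio_le`).

The uniform law comes from a compactness property of the logit kernels. Along any ultrafilter on
`ℝ^d` the functions `β ↦ exp ⟪z, β⟫` converge in `[0, ∞]`, for every `z`; what matters is that this
convergence already takes place along a *countably generated* coarser filter
(`exists_countablyGenerated_tendsto_exp_inner`). That filter is built by following the direction `u`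
in which `β` escapes to infinity, which settles all `z` not orthogonal to `u`, and recursing on the
orthogonal complement of `u`. Countable generation allows dominated convergence, so every ultrafilter
contains a set of `β` on which the kernels oscillate by less than `δ` in `L¹(M)`; by compactness of
the space of ultrafilters, `ℝ^d` is a finite union of such sets
(`exists_finite_partition_lintegral_kernelOsc_lt`). Replacing `G` by its masses on the pieces and
discretizing the simplex gives finitely many functions that approximate every `q(·; G)`, with an
error that is a convex combination of finitely many functions of small integral
(`exists_finite_net_choiceProb`). The ordinary strong law, applied to these finitely many functions,
suffices (`uniform_strong_law_infinitePi`).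

For the denominator of the posterior, `(G, x) ↦ q_j(x; G)` is jointly continuous, so that
`q(·; G) ≥ exp (-η) q(·; G₀)` on the compact set `𝒳` for all `G` in a weak neighbourhood `V` of `G₀`
(`eventually_exp_neg_mul_choiceProb_le`). The denominator is thus at least `Pi V * exp (-n η)`, with
`Pi V > 0` by the support condition, and `η < a` can be chosen.
-/

namespace MMNL

/-! ### Convergence of the logit kernels along ultrafilters -/

/-- Every ultrafilter is finer than some countably generated filter along which all the functions
`β ↦ exp ⟪z, β⟫`, `z ∈ W`, converge in `[0, ∞]`. If the projection of `β` to `W` is bounded along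
the ultrafilter, it converges. Otherwise it escapes to infinity in a limiting direction `u`, which
decides the limit for `z` not orthogonal to `u`, and the dimension of `W` drops. -/
theorem exists_countablyGenerated_tendsto_exp_inner {E : Type*} [NormedAddCommGroup E]
    [InnerProductSpace ℝ E] [FiniteDimensional ℝ E] (U : Ultrafilter E) (W : Submodule ℝ E) :
    ∃ F : Filter E, F.IsCountablyGenerated ∧ (U : Filter E) ≤ F ∧ ∀ z ∈ W, ∃ L : ℝ≥0∞,
      Tendsto (fun β => ENNReal.ofReal (Real.exp (inner ℝ z β))) F (𝓝 L) := by
  induction hn : Module.finrank ℝ W using Nat.strong_induction_on generalizing W with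
  | _ n ih =>
  have hproj : ∀ z ∈ W, ∀ β, inner ℝ z β = inner ℝ z (W.starProjection β) := fun z hz β => by
    rw [← Submodule.inner_starProjection_left_eq_right, Submodule.starProjection_eq_self_iff.2 hz]
  by_cases hb : ∃ R : ℝ, ∀ᶠ β in (U : Filter E), ‖W.starProjection β‖ ≤ R
  · obtain ⟨R, hR⟩ := hb
    obtain ⟨ψ, -, hψ⟩ := (isCompact_closedBall (0 : E) R).ultrafilter_le_nhds
      (U.map W.starProjection) (by
        rw [Ultrafilter.coe_map, le_principal_iff, mem_map]
        filter_upwards [hR] with β hβ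
        simpa using hβ)
    refine ⟨comap W.starProjection (𝓝 ψ), inferInstance, map_le_iff_le_comap.1 hψ,
      fun z hz => ⟨ENNReal.ofReal (Real.exp (inner ℝ z ψ)), ?_⟩⟩
    exact ((Continuous.tendsto (f := fun v : E => ENNReal.ofReal (Real.exp (inner ℝ z v)))
      (ENNReal.continuous_ofReal.comp (by fun_prop)) ψ).comp tendsto_comap).congr fun β => by
        rw [Function.comp_apply, ← hproj z hz]
  · push Not at hb
    have htop : Tendsto (fun β => ‖W.starProjection β‖) U atTop :=
      tendsto_atTop.2 fun R => by
        filter_upwards [hb R] with β hβ using hβ.le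
    -- `v β` is the direction of the projection of `β` to `W`
    let v : E → E := fun β => ‖W.starProjection β‖⁻¹ • W.starProjection β
    have hv1 : ∀ᶠ β in (U : Filter E), v β ∈ Metric.sphere (0 : E) 1 ∩ (W : Set E) := by
      filter_upwards [htop.eventually_gt_atTop 0] with β hβ
      refine ⟨?_, W.smul_mem _ (W.starProjection_apply_mem β)⟩
      simp [v, norm_smul, hβ.ne']
    obtain ⟨u, ⟨hu1, huW⟩, hu⟩ := ((isCompact_sphere (0 : E) 1).inter_right
      W.closed_of_finiteDimensional).ultrafilter_le_nhds (U.map v) (by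
        rw [Ultrafilter.coe_map, le_principal_iff, mem_map]; exact hv1)
    have hu1 : ‖u‖ = 1 := by simpa using hu1
    have hlt : W ⊓ (ℝ ∙ u)ᗮ < W := by
      refine lt_of_le_of_ne inf_le_left fun h => ?_
      have : u ∈ W ⊓ (ℝ ∙ u)ᗮ := by rw [h]; exact huW
      have h0 := Submodule.mem_orthogonal_singleton_iff_inner_right.1 this.2
      rw [real_inner_self_eq_norm_sq, hu1] at h0
      norm_num at h0
    obtain ⟨F, hF, hUF, hFz⟩ := ih _ (hn ▸ Submodule.finrank_lt_finrank_of_lt hlt) _ rfl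
    refine ⟨F ⊓ (comap v (𝓝 u) ⊓ comap (fun β => ‖W.starProjection β‖) atTop), inferInstance,
      le_inf hUF (le_inf (map_le_iff_le_comap.1 hu) (map_le_iff_le_comap.1 htop)),
      fun z hz => ?_⟩
    have hnorm : Tendsto (fun β => ‖W.starProjection β‖)
        (F ⊓ (comap v (𝓝 u) ⊓ comap (fun β => ‖W.starProjection β‖) atTop)) atTop :=
      tendsto_comap.mono_left (inf_le_right.trans inf_le_right)
    have hdir : Tendsto (fun β => inner ℝ z (v β))
        (F ⊓ (comap v (𝓝 u) ⊓ comap (fun β => ‖W.starProjection β‖) atTop)) (𝓝 (inner ℝ z u)) :=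
      (Continuous.tendsto (f := fun w : E => (inner ℝ z w : ℝ)) (by fun_prop) u).comp
        (tendsto_comap.mono_left (inf_le_right.trans inf_le_left))
    have heq : ∀ β, ‖W.starProjection β‖ * inner ℝ z (v β) = inner ℝ z β := fun β => by
      rw [hproj z hz β]
      simp only [v, inner_smul_right]
      by_cases h0 : ‖W.starProjection β‖ = 0
      · rw [norm_eq_zero.1 h0]; simp
      · field_simp
    -- `⟪z, β⟫ = ‖proj β‖ ⟪z, v β⟫` diverges, with the sign of `⟪z, u⟫`, unless that sign is zero
    rcases lt_trichotomy (inner ℝ z u) 0 with hs | hs | hs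
    · refine ⟨ENNReal.ofReal 0, ENNReal.tendsto_ofReal (Real.tendsto_exp_atBot.comp ?_)⟩
      exact (hnorm.atTop_mul_neg hs hdir).congr heq
    · obtain ⟨L, hL⟩ := hFz z ⟨hz, Submodule.mem_orthogonal_singleton_iff_inner_left.2 hs⟩
      exact ⟨L, hL.mono_left inf_le_left⟩
    · refine ⟨∞, ENNReal.tendsto_ofReal_atTop.comp (Real.tendsto_exp_atTop.comp ?_)⟩
      exact (hnorm.atTop_mul_pos hs hdir).congr heq

variable {J d : ℕ}

/-- The kernel as a continuous function, with values in `[0, ∞]`, of the exponentials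
`exp ⟪x_l - x_j, β⟫ ∈ [0, ∞]`; it remains meaningful when some of these tend to `0` or `∞`. -/
theorem ofReal_logitKernel (x : Cov J d) (j : Fin J) (β : Pref d) :
    ENNReal.ofReal (logitKernel x j β) =
      (∑ l, ENNReal.ofReal (Real.exp (inner ℝ (x l - x j) β)))⁻¹ := by
  have hpos : 0 < ∑ l, Real.exp (inner ℝ (x l - x j) β) :=
    Finset.sum_pos (fun l _ => Real.exp_pos _) ⟨j, Finset.mem_univ j⟩
  rw [← ENNReal.ofReal_sum_of_nonneg fun _ _ => (Real.exp_pos _).le,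
    ← ENNReal.ofReal_inv_of_pos hpos]
  congr 1
  simp_rw [logitKernel, inner_sub_left, Real.exp_sub, ← Finset.sum_div, inv_div]

theorem logitKernel_le_one (x : Cov J d) (j : Fin J) (β : Pref d) : logitKernel x j β ≤ 1 := by
  have : NeZero J := ⟨j.pos.ne'⟩
  rw [← sum_logitKernel x β]
  exact Finset.single_le_sum (f := fun i => logitKernel x i β)
    (fun i _ => logitKernel_nonneg x i β) (Finset.mem_univ j)

theorem exists_countablyGenerated_tendsto_logitKernel (U : Ultrafilter (Pref d)) :
    ∃ F : Filter (Pref d), F.IsCountablyGenerated ∧ (U : Filter (Pref d)) ≤ F ∧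
      ∀ x : Cov J d, ∃ L : Fin J → ℝ, Tendsto (fun β j => logitKernel x j β) F (𝓝 L) := by
  obtain ⟨F, hF, hU, h⟩ := exists_countablyGenerated_tendsto_exp_inner U ⊤
  refine ⟨F, hF, hU, fun x => ?_⟩
  suffices ∀ j, ∃ L : ℝ, Tendsto (logitKernel x j) F (𝓝 L) by
    choose L hL using this
    exact ⟨L, tendsto_pi_nhds.2 hL⟩
  intro j
  choose L hL using fun z => h z trivial
  have ht : Tendsto (fun β => ENNReal.ofReal (logitKernel x j β)) F
      (𝓝 (∑ l, L (x l - x j))⁻¹) := by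
    simp_rw [ofReal_logitKernel]
    exact (tendsto_finsetSum _ fun l _ => hL _).inv
  refine ⟨((∑ l, L (x l - x j))⁻¹).toReal, ?_⟩
  have hfin : (∑ l, L (x l - x j))⁻¹ ≠ ∞ := by
    have : NeBot F := U.neBot'.mono hU
    refine (lt_of_le_of_lt (le_of_tendsto' ht fun β => ?_) ENNReal.one_lt_top).ne
    exact ENNReal.ofReal_le_one.2 (logitKernel_le_one x j β)
  refine ((ENNReal.tendsto_toReal hfin).comp ht).congr fun β => ?_
  exact ENNReal.toReal_ofReal (logitKernel_nonneg x j β)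

/-- The oscillation over `β ∈ S` of the vector of logit kernels at the covariate `x`: the diameter of
the set of its values, in `ℝ^J` with the sup norm. -/
noncomputable def kernelOsc (S : Set (Pref d)) (x : Cov J d) : ℝ≥0∞ :=
  Metric.ediam ((fun (β : Pref d) (j : Fin J) => logitKernel x j β) '' S)

theorem continuous_logitKernel_vec :
    Continuous fun p : Cov J d × Pref d => fun j : Fin J => logitKernel p.1 j p.2 :=
  continuous_pi fun j => continuous_logitKernel j

/-- The oscillation is a supremum of continuous functions of `x`, hence lower semicontinuous; no
measurability of `S` is needed. -/
theorem measurable_kernelOsc (S : Set (Pref d)) : Measurable (kernelOsc (J := J) S) := by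
  refine LowerSemicontinuous.measurable ?_
  have : kernelOsc (J := J) S = fun x => ⨆ β ∈ S, ⨆ γ ∈ S,
      edist (fun j : Fin J => logitKernel x j β) (fun j : Fin J => logitKernel x j γ) := by
    ext x
    simp only [kernelOsc, Metric.ediam, iSup_image]
  rw [this]
  refine lowerSemicontinuous_biSup fun β _ => lowerSemicontinuous_biSup fun γ _ =>
    Continuous.lowerSemicontinuous (Continuous.edist ?_ ?_)
  · exact continuous_logitKernel_vec.comp (Continuous.prodMk_left β)
  · exact continuous_logitKernel_vec.comp (Continuous.prodMk_left γ)

theorem kernelOsc_mono {S T : Set (Pref d)} (h : S ⊆ T) (x : Cov J d) :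
    kernelOsc S x ≤ kernelOsc T x :=
  Metric.ediam_mono (Set.image_mono h)

theorem kernelOsc_closure (S : Set (Pref d)) (x : Cov J d) :
    kernelOsc (closure S) x = kernelOsc S x := by
  refine le_antisymm ?_ (kernelOsc_mono subset_closure x)
  rw [kernelOsc, kernelOsc, ← Metric.ediam_closure (Set.image _ S)]
  exact Metric.ediam_mono (image_closure_subset_closure_image
    (continuous_logitKernel_vec.comp (Continuous.prodMk_right x)))

theorem kernelOsc_le_one (S : Set (Pref d)) (x : Cov J d) : kernelOsc S x ≤ 1 := by
  refine Metric.ediam_le ?_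
  rintro _ ⟨β, -, rfl⟩ _ ⟨γ, -, rfl⟩
  rw [edist_dist, ENNReal.ofReal_le_one]
  refine (dist_pi_le_iff zero_le_one).2 fun j => ?_
  rw [Real.dist_eq, abs_le]
  constructor <;> linarith [logitKernel_nonneg x j β, logitKernel_nonneg x j γ,
    logitKernel_le_one x j β, logitKernel_le_one x j γ]

theorem abs_logitKernel_sub_le {S : Set (Pref d)} {β γ : Pref d} (hβ : β ∈ S) (hγ : γ ∈ S)
    (x : Cov J d) (j : Fin J) :
    |logitKernel x j β - logitKernel x j γ| ≤ (kernelOsc S x).toReal := by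
  rw [← Real.dist_eq, dist_edist]
  refine ENNReal.toReal_mono ((kernelOsc_le_one S x).trans_lt ENNReal.one_lt_top).ne ?_
  exact (edist_le_pi_edist (fun j => logitKernel x j β) (fun j => logitKernel x j γ) j).trans
    (Metric.edist_le_ediam_of_mem ⟨β, hβ, rfl⟩ ⟨γ, hγ, rfl⟩)

theorem exists_mem_ultrafilter_lintegral_kernelOsc_lt (M : Measure (Cov J d)) [IsFiniteMeasure M]
    (U : Ultrafilter (Pref d)) {δ : ℝ≥0∞} (hδ : 0 < δ) :
    ∃ S ∈ U, ∫⁻ x, kernelOsc S x ∂M < δ := by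
  obtain ⟨F, hF, hU, h⟩ := exists_countablyGenerated_tendsto_logitKernel (J := J) U
  have : NeBot F := U.neBot'.mono hU
  obtain ⟨S, hS⟩ := F.exists_antitone_basis
  have hlim : Tendsto (fun n => ∫⁻ x, kernelOsc (S n) x ∂M) atTop (𝓝 (∫⁻ _, 0 ∂M)) := by
    refine tendsto_lintegral_of_dominated_convergence (fun _ => 1)
      (fun n => measurable_kernelOsc _) (fun n => Eventually.of_forall fun x => kernelOsc_le_one _ x)
      (by simp) (Eventually.of_forall fun x => ?_)
    obtain ⟨L, hL⟩ := h x
    rw [ENNReal.tendsto_nhds_zero]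
    intro ε hε
    have hball := hL (Metric.eball_mem_nhds L (ENNReal.half_pos hε.ne'))
    obtain ⟨n, hn⟩ := hS.mem_iff.1 hball
    filter_upwards [eventually_ge_atTop n] with m hm
    refine (kernelOsc_mono (hS.antitone hm) x).trans ?_
    refine (Metric.ediam_mono (Set.image_subset_iff.2 hn)).trans ?_
    exact Metric.ediam_eball_le.trans_eq (ENNReal.mul_div_cancel two_ne_zero ENNReal.ofNat_ne_top)
  rw [lintegral_zero] at hlim
  obtain ⟨n, hn⟩ := (hlim.eventually_lt_const hδ).exists
  exact ⟨S n, hU (hS.mem n), hn⟩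

/-- The space of preference vectors splits into finitely many measurable pieces on each of which the
logit kernels oscillate little in `L¹(M)`, although the space is not compact. -/
theorem exists_finite_partition_lintegral_kernelOsc_lt (M : Measure (Cov J d)) [IsFiniteMeasure M]
    {δ : ℝ≥0∞} (hδ : 0 < δ) :
    ∃ (m : ℕ) (T : Fin m → Set (Pref d)), (∀ i, MeasurableSet (T i)) ∧
      Pairwise (Function.onFun Disjoint T) ∧ ⋃ i, T i = Set.univ ∧
      ∀ i, ∫⁻ x, kernelOsc (T i) x ∂M < δ := by
  -- The sets covered by finitely many sets of small oscillation form an ideal. If it were proper,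
  -- an ultrafilter containing the complements of its members would contain no such set.
  let p : Set (Pref d) → Prop := fun t => ∃ C : Set (Set (Pref d)), C.Finite ∧
    (∀ S ∈ C, ∫⁻ x, kernelOsc (J := J) S x ∂M < δ) ∧ t ⊆ ⋃₀ C
  have huniv : p Set.univ := by
    by_contra hnot
    let 𝓕 : Filter (Pref d) := Filter.comk p ⟨∅, Set.finite_empty, by simp, by simp⟩
      (fun t ⟨C, hC, hS, ht⟩ s hs => ⟨C, hC, hS, hs.trans ht⟩)
      (fun s ⟨C, hC, hS, hs⟩ t ⟨D, hD, hS', ht⟩ => ⟨C ∪ D, hC.union hD,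
        fun S h => h.elim (hS S) (hS' S), by
          rw [Set.sUnion_union]; exact Set.union_subset_union hs ht⟩)
    have hne : NeBot 𝓕 := ⟨fun h => hnot (by
      have : (∅ : Set (Pref d)) ∈ 𝓕 := h ▸ mem_bot
      simpa [𝓕] using this)⟩
    obtain ⟨S, hS, hSδ⟩ := exists_mem_ultrafilter_lintegral_kernelOsc_lt M (Ultrafilter.of 𝓕) hδ
    have hSc : Sᶜ ∈ Ultrafilter.of 𝓕 := Ultrafilter.of_le 𝓕 (by
      rw [Filter.mem_comk, compl_compl]
      exact ⟨{S}, Set.finite_singleton S, by simpa using hSδ, by simp⟩)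
    exact Ultrafilter.compl_notMem_iff.2 hS hSc
  obtain ⟨C, hC, hS, hcov⟩ := huniv
  obtain ⟨m, S, hSinj, rfl⟩ := hC.fin_param
  -- closures are measurable and have the same oscillation
  refine ⟨m, disjointed fun i => closure (S i), fun i => ?_, disjoint_disjointed _, ?_, fun i => ?_⟩
  · exact disjointedRec (fun _ _ ht => ht.diff isClosed_closure.measurableSet)
      isClosed_closure.measurableSet
  · rw [iUnion_disjointed, Set.eq_univ_iff_forall]
    intro β
    obtain ⟨_, ⟨i, rfl⟩, hβ⟩ := hcov (Set.mem_univ β)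
    exact Set.mem_iUnion.2 ⟨i, subset_closure hβ⟩
  · refine (lintegral_mono fun x => ?_).trans_lt (hS (S i) ⟨i, rfl⟩)
    exact (kernelOsc_mono (disjointed_subset _ i) x).trans (kernelOsc_closure _ x).le

/-! ### A uniform strong law of large numbers -/

theorem strong_law_infinitePi {Z : Type*} [MeasurableSpace Z] (P : Measure Z)
    [IsProbabilityMeasure P] {f : Z → ℝ} (hm : Measurable f) (hf : Integrable f P) :
    ∀ᵐ ω ∂Measure.infinitePi (fun _ : ℕ => P),
      Tendsto (fun n : ℕ => (∑ t ∈ Finset.range n, f (ω t)) / n) atTop (𝓝 (∫ z, f z ∂P)) := by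
  have hmp : ∀ t, MeasurePreserving (fun ω : ℕ → Z => ω t) (Measure.infinitePi fun _ => P) P :=
    fun t => measurePreserving_eval_infinitePi _ t
  have hlaw := ProbabilityTheory.strong_law_ae_real
    (μ := Measure.infinitePi (fun _ : ℕ => P)) (fun t ω => f (ω t))
    ((hmp 0).integrable_comp_of_integrable hf)
    (fun s t hst => (ProbabilityTheory.iIndepFun_infinitePi (P := fun _ : ℕ => P)
      (X := fun _ => f) fun _ => hm).indepFun hst)
    (fun t => ⟨(hm.comp (hmp t).measurable).aemeasurable, (hm.comp (hmp 0).measurable).aemeasurable,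
      by
        change Measure.map (f ∘ fun ω : ℕ → Z => ω t) _ = Measure.map (f ∘ fun ω : ℕ → Z => ω 0) _
        rw [← Measure.map_map hm (hmp t).measurable, ← Measure.map_map hm (hmp 0).measurable,
          (hmp t).map_eq, (hmp 0).map_eq]⟩)
  have hint : ∫ ω, f (ω 0) ∂Measure.infinitePi (fun _ : ℕ => P) = ∫ z, f z ∂P := by
    conv_rhs => rw [← (hmp 0).map_eq]
    exact (integral_map (hmp 0).measurable.aemeasurable hm.aestronglyMeasurable).symm
  rwa [hint] at hlaw

theorem ae_forall_infinitePi {Z : Type*} [MeasurableSpace Z] (P : Measure Z)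
    [IsProbabilityMeasure P] {p : Z → Prop} (h : ∀ᵐ z ∂P, p z) :
    ∀ᵐ ω ∂Measure.infinitePi (fun _ : ℕ => P), ∀ t, p (ω t) :=
  ae_all_iff.2 fun t =>
    (measurePreserving_eval_infinitePi (fun _ : ℕ => P) t).quasiMeasurePreserving.ae h

theorem ae_eventually_sum_le_infinitePi {Z : Type*} [MeasurableSpace Z] (P : Measure Z)
    [IsProbabilityMeasure P] {f : Z → ℝ} (hm : Measurable f) (hf : Integrable f P) {δ : ℝ}
    (hδ : 0 < δ) :
    ∀ᵐ ω ∂Measure.infinitePi (fun _ : ℕ => P), ∀ᶠ n : ℕ in atTop,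
      ∑ t ∈ Finset.range n, f (ω t) ≤ n * (∫ z, f z ∂P + δ) := by
  filter_upwards [strong_law_infinitePi P hm hf] with ω hω
  filter_upwards [hω.eventually_le_const (lt_add_of_pos_right _ hδ), eventually_gt_atTop 0]
    with n hn h0
  rwa [div_le_iff₀' (by exact_mod_cast h0)] at hn

/-- A one-sided uniform strong law for a family `f` that is approximated, for every `δ > 0`, by
finitely many functions `h k` up to `δ` plus a convex combination of finitely many functions `e i`
with mean at most `δ`. The weights `g` may depend on the member of the family, since the averages of
the `e i` bound those of all their convex combinations. -/
theorem uniform_strong_law_infinitePi {Z ι : Type*} [MeasurableSpace Z] (P : Measure Z)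
    [IsProbabilityMeasure P] {Z₀ : Set Z} (hZ₀ : ∀ᵐ z ∂P, z ∈ Z₀) (f : ι → Z → ℝ)
    (hf : ∀ s, Integrable (f s) P)
    (H : ∀ δ : ℝ, 0 < δ → ∃ (K m : ℕ) (h : Fin K → Z → ℝ) (e : Fin m → Z → ℝ),
      (∀ k, Measurable (h k) ∧ Integrable (h k) P) ∧
      (∀ i, Measurable (e i) ∧ Integrable (e i) P ∧ ∫ z, e i z ∂P ≤ δ) ∧
      ∀ s, ∃ k, ∃ g ∈ stdSimplex ℝ (Fin m), ∀ z ∈ Z₀, |f s z - h k z| ≤ δ + ∑ i, g i * e i z)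
    {δ : ℝ} (hδ : 0 < δ) :
    ∀ᵐ ω ∂Measure.infinitePi (fun _ : ℕ => P), ∀ᶠ n : ℕ in atTop, ∀ s,
      ∑ t ∈ Finset.range n, f s (ω t) ≤ n * (∫ z, f s z ∂P + δ) := by
  -- One `δ / 6` is lost in the law for `h k`, one in that for `e i`, and two (the `δ` of `H` and the
  -- mean of `e i`) each time `f s` is exchanged with `h k`.
  obtain ⟨K, m, h, e, hh, he, happ⟩ := H (δ / 6) (by positivity)
  have h1 := ae_all_iff.2 fun k =>
    ae_eventually_sum_le_infinitePi P (hh k).1 (hh k).2 (show 0 < δ / 6 by positivity)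
  have h2 := ae_all_iff.2 fun i =>
    ae_eventually_sum_le_infinitePi P (he i).1 (he i).2.1 (show 0 < δ / 6 by positivity)
  filter_upwards [h1, h2, ae_forall_infinitePi P hZ₀] with ω hω1 hω2 hω0
  filter_upwards [eventually_all.2 hω1, eventually_all.2 hω2] with n hn1 hn2 s
  obtain ⟨k, g, ⟨hg0, hg1⟩, hfs⟩ := happ s
  have hie : Integrable (fun z => ∑ i, g i * e i z) P :=
    integrable_finsetSum _ fun i _ => (he i).2.1.const_mul _
  have hie' : Integrable (fun z => δ / 6 + ∑ i, g i * e i z) P := (integrable_const _).add hie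
  have hmean : ∫ z, h k z ∂P ≤ ∫ z, f s z ∂P + 2 * (δ / 6) := by
    have hbd : ∫ z, h k z ∂P ≤ ∫ z, (f s z + (δ / 6 + ∑ i, g i * e i z)) ∂P := by
      refine integral_mono_ae (hh k).2 ((hf s).add hie') ?_
      filter_upwards [hZ₀] with z hz
      linarith [(abs_le.1 (hfs z hz)).1]
    rw [integral_add (hf s) hie', integral_add (integrable_const _) hie,
      integral_finsetSum _ fun i _ => (he i).2.1.const_mul _] at hbd
    simp only [integral_const, probReal_univ, one_smul, integral_const_mul] at hbd
    have : ∑ i, g i * ∫ z, e i z ∂P ≤ ∑ i, g i * (δ / 6) :=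
      Finset.sum_le_sum fun i _ => mul_le_mul_of_nonneg_left (he i).2.2 (hg0 i)
    rw [← Finset.sum_mul, hg1] at this
    linarith
  have herr : ∑ i, g i * ∑ t ∈ Finset.range n, e i (ω t) ≤ n * (2 * (δ / 6)) := by
    calc ∑ i, g i * ∑ t ∈ Finset.range n, e i (ω t)
        ≤ ∑ i, g i * (n * (2 * (δ / 6))) := Finset.sum_le_sum fun i _ =>
          mul_le_mul_of_nonneg_left ((hn2 i).trans (mul_le_mul_of_nonneg_left
            (by linarith [(he i).2.2]) n.cast_nonneg)) (hg0 i)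
      _ = n * (2 * (δ / 6)) := by rw [← Finset.sum_mul, hg1, one_mul]
  calc ∑ t ∈ Finset.range n, f s (ω t)
      ≤ ∑ t ∈ Finset.range n, (h k (ω t) + (δ / 6 + ∑ i, g i * e i (ω t))) :=
        Finset.sum_le_sum fun t _ => by linarith [(abs_le.1 (hfs _ (hω0 t))).2]
    _ = ∑ t ∈ Finset.range n, h k (ω t) + (n * (δ / 6)
          + ∑ i, g i * ∑ t ∈ Finset.range n, e i (ω t)) := by
        rw [Finset.sum_add_distrib, Finset.sum_add_distrib, Finset.sum_comm]
        simp [Finset.mul_sum]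
    _ ≤ n * (∫ z, h k z ∂P + δ / 6) + (n * (δ / 6) + n * (2 * (δ / 6))) := by
        gcongr; exact hn1 k
    _ = n * (∫ z, h k z ∂P + 4 * (δ / 6)) := by ring
    _ ≤ n * (∫ z, f s z ∂P + δ) := mul_le_mul_of_nonneg_left (by linarith) n.cast_nonneg

/-! ### Choice probabilities as functions of the mixing distribution -/

theorem choiceProb_nonneg (G : Mix d) (x : Cov J d) (j : Fin J) : 0 ≤ choiceProb G x j :=
  integral_nonneg (logitKernel_nonneg x j)

theorem choiceProb_le_one (G : Mix d) (x : Cov J d) (j : Fin J) : choiceProb G x j ≤ 1 := by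
  have : NeZero J := ⟨j.pos.ne'⟩
  rw [← sum_choiceProb G x]
  exact Finset.single_le_sum (f := choiceProb G x) (fun i _ => choiceProb_nonneg G x i)
    (Finset.mem_univ j)

/-- Joint continuity in `G` (for the weak topology) and `x`: `q_j(x; G)` is the integral of the
bounded continuous function `(x, β) ↦ k_j(x, β)` against `δ_x ⊗ G`, which depends continuously on
`(G, x)`. -/
theorem continuous_choiceProb (j : Fin J) :
    Continuous fun p : Mix d × Cov J d => choiceProb p.1 p.2 j := by
  let κ : BoundedContinuousFunction (Cov J d × Pref d) ℝ :=
    BoundedContinuousFunction.ofNormedAddCommGroup (fun p => logitKernel p.1 j p.2)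
      (continuous_logitKernel j) 1 fun p => by
        rw [Real.norm_of_nonneg (logitKernel_nonneg _ _ _)]; exact logitKernel_le_one _ _ _
  have h : ∀ p : Mix d × Cov J d, choiceProb p.1 p.2 j =
      ∫ y, κ y ∂(((diracProba p.2).prod p.1 : ProbabilityMeasure (Cov J d × Pref d)) :
        Measure (Cov J d × Pref d)) := fun p => by
    change _ = ∫ y, κ y ∂((Measure.dirac p.2).prod (p.1 : Measure (Pref d)))
    rw [Measure.dirac_prod, integral_map (by fun_prop) κ.continuous.aestronglyMeasurable]
    rfl
  simp_rw [h]
  exact (ProbabilityMeasure.continuous_integral_boundedContinuousFunction κ).comp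
    (ProbabilityMeasure.continuous_prod.comp
      ((continuous_diracProba.comp continuous_snd).prodMk continuous_fst))

theorem measurable_choiceProb_mix (x : Cov J d) (j : Fin J) :
    Measurable fun G : Mix d => choiceProb G x j := by
  have hc : Continuous (logitKernel (d := d) x j) :=
    (continuous_logitKernel j).comp (Continuous.prodMk_right x)
  have h : ∀ G : Mix d, choiceProb G x j =
      (∫⁻ β, ENNReal.ofReal (logitKernel x j β) ∂(G : Measure (Pref d))).toReal := fun G =>
    integral_eq_lintegral_of_nonneg_ae (Eventually.of_forall (logitKernel_nonneg x j))
      hc.aestronglyMeasurable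
  simp_rw [h]
  exact ((Measure.measurable_lintegral hc.measurable.ennreal_ofReal).comp
    measurable_subtype_coe).ennreal_toReal

theorem measurable_likelihoodRatio (G₀ : Mix d) (n : ℕ) (ω : ℕ → Fin J × Cov J d) :
    Measurable (likelihoodRatio G₀ n ω) :=
  Finset.measurable_fun_prod _ fun _ _ => (measurable_choiceProb_mix _ _).div_const _

theorem exists_forall_le_choiceProb {G : Mix d} {𝒳 : Set (Cov J d)} (h𝒳 : IsCompact 𝒳)
    (h : ∀ (j : Fin J), ∀ x ∈ 𝒳, 0 < choiceProb G x j) :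
    ∃ c : ℝ, 0 < c ∧ c ≤ 1 ∧ ∀ (j : Fin J), ∀ x ∈ 𝒳, c ≤ choiceProb G x j := by
  have hj : ∀ j : Fin J, ∃ c : ℝ, 0 < c ∧ ∀ x ∈ 𝒳, c ≤ choiceProb G x j := fun j =>
    h𝒳.exists_forall_le' ((continuous_choiceProb j).comp
      (Continuous.prodMk_right G)).continuousOn (h j)
  choose c hc0 hc using hj
  by_cases hJ : Nonempty (Fin J)
  · refine ⟨Finset.univ.inf' Finset.univ_nonempty fun j => min (c j) 1, ?_, ?_, fun j x hx => ?_⟩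
    · simp [Finset.lt_inf'_iff, hc0]
    · obtain ⟨j⟩ := hJ
      exact (Finset.inf'_le _ (Finset.mem_univ j)).trans (min_le_right _ _)
    · exact (Finset.inf'_le _ (Finset.mem_univ j)).trans ((min_le_left _ _).trans (hc j x hx))
  · exact ⟨1, one_pos, le_rfl, fun j => (hJ ⟨j⟩).elim⟩

theorem eventually_exp_neg_mul_choiceProb_le {G₀ : Mix d} {𝒳 : Set (Cov J d)} (h𝒳 : IsCompact 𝒳)
    (h : ∀ (j : Fin J), ∀ x ∈ 𝒳, 0 < choiceProb G₀ x j) {η : ℝ} (hη : 0 < η) :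
    ∀ᶠ G in 𝓝 G₀, ∀ x ∈ 𝒳, ∀ j, Real.exp (-η) * choiceProb G₀ x j ≤ choiceProb G x j := by
  refine h𝒳.eventually_forall_of_forall_eventually fun x hx => eventually_all.2 fun j => ?_
  have hlt : Real.exp (-η) * choiceProb G₀ x j < choiceProb G₀ x j :=
    mul_lt_of_lt_one_left (h j x hx) (by rwa [Real.exp_lt_one_iff, neg_lt_zero])
  have hl : Continuous fun p : Mix d × Cov J d => Real.exp (-η) * choiceProb G₀ p.2 j :=
    ((continuous_choiceProb j).comp (continuous_const.prodMk continuous_snd)).const_mul _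
  exact ((hl.tendsto (G₀, x)).eventually_lt ((continuous_choiceProb j).tendsto (G₀, x)) hlt).mono
    fun p hp => hp.le

/-- Mixtures over finitely many fixed points `b i` approximate all choice probabilities; the weights
are the masses that `G` gives to the pieces of a partition, and `o i` is the oscillation of the
kernels on the `i`-th piece. -/
theorem exists_finite_mixture_approx (M : Measure (Cov J d)) [IsFiniteMeasure M]
    {δ : ℝ} (hδ : 0 < δ) :
    ∃ (m : ℕ) (b : Fin m → Pref d) (o : Fin m → Cov J d → ℝ),
      (∀ i, Measurable (o i) ∧ Integrable (o i) M ∧ ∫ x, o i x ∂M ≤ δ) ∧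
      ∀ G : Mix d, ∃ g ∈ stdSimplex ℝ (Fin m), ∀ (x : Cov J d) (j : Fin J),
        |choiceProb G x j - ∑ i, g i * logitKernel x j (b i)| ≤ ∑ i, g i * o i x := by
  obtain ⟨m, T, hTm, hTd, hTu, hT⟩ := exists_finite_partition_lintegral_kernelOsc_lt M
    (ENNReal.ofReal_pos.2 hδ)
  -- pieces may be empty, in which case the point is arbitrary and its weight is zero
  have hb : ∀ i, ∃ b : Pref d, (T i).Nonempty → b ∈ T i := fun i => by
    by_cases hi : (T i).Nonempty
    · exact ⟨hi.some, fun _ => hi.some_mem⟩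
    · exact ⟨0, fun h => (hi h).elim⟩
  choose b hb using hb
  have hom : ∀ i, Measurable fun x : Cov J d => (kernelOsc (T i) x).toReal :=
    fun i => (measurable_kernelOsc _).ennreal_toReal
  refine ⟨m, b, fun i x => (kernelOsc (T i) x).toReal, fun i => ⟨hom i, ?_, ?_⟩, fun G => ?_⟩
  · refine Integrable.of_bound (hom i).aestronglyMeasurable 1 (Eventually.of_forall fun x => ?_)
    rw [Real.norm_of_nonneg ENNReal.toReal_nonneg]
    exact ENNReal.toReal_le_of_le_ofReal zero_le_one (by simpa using kernelOsc_le_one (T i) x)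
  · rw [integral_toReal (measurable_kernelOsc _).aemeasurable (Eventually.of_forall fun x =>
      (kernelOsc_le_one (T i) x).trans_lt ENNReal.one_lt_top)]
    exact ENNReal.toReal_le_of_le_ofReal hδ.le (hT i).le
  · refine ⟨fun i => (G : Measure (Pref d)).real (T i), ⟨fun i => measureReal_nonneg, ?_⟩,
      fun x j => ?_⟩
    · rw [← measureReal_iUnion_fintype hTd hTm, hTu, probReal_univ]
    · have : NeZero J := ⟨j.pos.ne'⟩
      have hint := integrable_logitKernel G x j
      rw [choiceProb, ← setIntegral_univ, ← hTu, integral_iUnion_fintype hTm hTd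
        fun i => hint.integrableOn, ← Finset.sum_sub_distrib]
      refine (Finset.abs_sum_le_sum_abs _ _).trans (Finset.sum_le_sum fun i _ => ?_)
      have hc : (G : Measure (Pref d)).real (T i) * logitKernel x j (b i) =
          ∫ _ in T i, logitKernel x j (b i) ∂(G : Measure (Pref d)) := by simp
      rw [hc, ← integral_sub hint.integrableOn (integrable_const _), mul_comm,
        ← Real.norm_eq_abs]
      refine norm_setIntegral_le_of_norm_le_const (measure_lt_top _ _) fun β hβ => ?_
      exact abs_logitKernel_sub_le hβ (hb i ⟨β, hβ⟩) x j

theorem exists_finite_net_stdSimplex (m : ℕ) {δ : ℝ} (hδ : 0 < δ) :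
    ∃ (K : ℕ) (w : Fin K → Fin m → ℝ), (∀ k, w k ∈ stdSimplex ℝ (Fin m)) ∧
      ∀ g ∈ stdSimplex ℝ (Fin m), ∃ k, ∑ i, |g i - w k i| ≤ δ := by
  obtain ⟨t, hts, htf, hcov⟩ := Metric.finite_approx_of_totallyBounded
    (isCompact_stdSimplex ℝ (Fin m)).totallyBounded (δ / (m + 1)) (by positivity)
  obtain ⟨K, w, -, rfl⟩ := htf.fin_param
  refine ⟨K, w, fun k => hts ⟨k, rfl⟩, fun g hg => ?_⟩
  obtain ⟨_, ⟨k, rfl⟩, hk⟩ := Set.mem_iUnion₂.1 (hcov hg)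
  refine ⟨k, ?_⟩
  calc ∑ i, |g i - w k i| ≤ ∑ _ : Fin m, δ / (m + 1) := Finset.sum_le_sum fun i _ => by
        rw [← Real.dist_eq]; exact (dist_le_pi_dist g (w k) i).trans (Metric.mem_ball.1 hk).le
    _ = m * (δ / (m + 1)) := by simp
    _ ≤ (m + 1) * (δ / (m + 1)) := by gcongr; linarith
    _ = δ := by field_simp

/-- All vectors of choice probabilities are approximated by finitely many functions, up to `δ` plus
a convex combination of finitely many functions with small integral. -/
theorem exists_finite_net_choiceProb (M : Measure (Cov J d)) [IsFiniteMeasure M]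
    {δ : ℝ} (hδ : 0 < δ) :
    ∃ (K m : ℕ) (h : Fin K → Cov J d → Fin J → ℝ) (o : Fin m → Cov J d → ℝ),
      (∀ k j, Measurable (fun x => h k x j) ∧ ∀ x, h k x j ∈ Set.Icc 0 1) ∧
      (∀ i, Measurable (o i) ∧ Integrable (o i) M ∧ ∫ x, o i x ∂M ≤ δ) ∧
      ∀ G : Mix d, ∃ k, ∃ g ∈ stdSimplex ℝ (Fin m), ∀ (x : Cov J d) (j : Fin J),
        |choiceProb G x j - h k x j| ≤ δ + ∑ i, g i * o i x := by
  obtain ⟨m, b, o, ho, happ⟩ := exists_finite_mixture_approx M hδ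
  obtain ⟨K, w, hw, hnet⟩ := exists_finite_net_stdSimplex m hδ
  refine ⟨K, m, fun k x j => ∑ i, w k i * logitKernel x j (b i), o, fun k j => ⟨?_, fun x => ?_⟩,
    ho, fun G => ?_⟩
  · exact Finset.measurable_fun_sum _ fun i _ => (((continuous_logitKernel j).comp
      (Continuous.prodMk_left (b i))).measurable).const_mul _
  · refine ⟨Finset.sum_nonneg fun i _ => mul_nonneg ((hw k).1 i) (logitKernel_nonneg _ _ _), ?_⟩
    rw [← (hw k).2]
    exact Finset.sum_le_sum fun i _ => mul_le_of_le_one_right ((hw k).1 i) (logitKernel_le_one _ _ _)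
  · obtain ⟨g, hg, hGg⟩ := happ G
    obtain ⟨k, hk⟩ := hnet g hg
    refine ⟨k, g, hg, fun x j => ?_⟩
    have h2 : |∑ i, g i * logitKernel x j (b i) - ∑ i, w k i * logitKernel x j (b i)| ≤ δ := by
      rw [← Finset.sum_sub_distrib]
      refine (Finset.abs_sum_le_sum_abs _ _).trans (le_trans (Finset.sum_le_sum fun i _ => ?_) hk)
      rw [← sub_mul, abs_mul, abs_of_nonneg (logitKernel_nonneg _ _ _)]
      exact mul_le_of_le_one_right (abs_nonneg _) (logitKernel_le_one _ _ _)
    linarith [abs_sub_le (choiceProb G x j) (∑ i, g i * logitKernel x j (b i))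
      (∑ i, w k i * logitKernel x j (b i)), hGg x j]

/-! ### The score and bounds on the likelihood ratio -/

/-- The quadratic `(t - 1) - (c/4) (t - 1)²`, which dominates `log t` for `0 < t ≤ 1/c`. -/
noncomputable def chiScore (c t : ℝ) : ℝ := (t - 1) - c / 4 * (t - 1) ^ 2

/-- Exponential form of `log t ≤ chiScore c t`, valid also at `t = 0`. With `t = s²`, it follows from
`log s ≤ s - 1`, which gives `log t ≤ (t - 1) - (s - 1)²`, and from
`(s - 1)² = (t - 1)² / (s + 1)²`, where `(s + 1)² ≤ 4 / c`. -/
theorem le_exp_chiScore {c t : ℝ} (hc0 : 0 < c) (hc1 : c ≤ 1) (ht0 : 0 ≤ t) (ht : t ≤ c⁻¹) :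
    t ≤ Real.exp (chiScore c t) := by
  rcases ht0.eq_or_lt with rfl | ht0
  · positivity
  rw [← Real.log_le_iff_le_exp ht0]
  obtain ⟨s, hs, rfl⟩ : ∃ s : ℝ, 0 < s ∧ s ^ 2 = t :=
    ⟨√t, Real.sqrt_pos.2 ht0, Real.sq_sqrt ht0.le⟩
  have hlog : Real.log (s ^ 2) ≤ (s ^ 2 - 1) - (s - 1) ^ 2 := by
    rw [Real.log_pow]
    push_cast
    nlinarith [Real.log_le_sub_one_of_pos hs]
  have hcs : c * s ^ 2 ≤ 1 := by
    calc c * s ^ 2 ≤ c * c⁻¹ := by gcongr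
      _ = 1 := mul_inv_cancel₀ hc0.ne'
  have hquad : c / 4 * (s + 1) ^ 2 ≤ 1 := by nlinarith [mul_nonneg hc0.le (sq_nonneg (s - 1))]
  have := mul_le_mul_of_nonneg_right hquad (sq_nonneg (s - 1))
  unfold chiScore
  nlinarith

theorem abs_chiScore_sub_le {c s t : ℝ} (hc0 : 0 < c) (hc1 : c ≤ 1) (hs0 : 0 ≤ s) (hs : s ≤ c⁻¹)
    (ht0 : 0 ≤ t) (ht : t ≤ c⁻¹) : |chiScore c s - chiScore c t| ≤ 2 * |s - t| := by
  have heq : chiScore c s - chiScore c t = (1 - c / 4 * (s + t - 2)) * (s - t) := by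
    unfold chiScore; ring
  have hcs : c * s ≤ 1 := by
    calc c * s ≤ c * c⁻¹ := by gcongr
      _ = 1 := mul_inv_cancel₀ hc0.ne'
  have hct : c * t ≤ 1 := by
    calc c * t ≤ c * c⁻¹ := by gcongr
      _ = 1 := mul_inv_cancel₀ hc0.ne'
  rw [heq, abs_mul]
  refine mul_le_mul_of_nonneg_right (abs_le.2 ⟨?_, ?_⟩) (abs_nonneg _) <;>
    nlinarith [mul_nonneg hc0.le hs0, mul_nonneg hc0.le ht0]

theorem measurable_chiScore (c : ℝ) : Measurable (chiScore c) := by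
  unfold chiScore; fun_prop

theorem choiceProb_mem_Icc (G : Mix d) (x : Cov J d) (j : Fin J) :
    choiceProb G x j ∈ Set.Icc (0 : ℝ) 1 :=
  ⟨choiceProb_nonneg G x j, choiceProb_le_one G x j⟩

theorem continuous_choiceVec (G : Mix d) : Continuous (choiceVec (J := J) G) :=
  (PiLp.continuous_toLp 2 _).comp (continuous_pi fun j =>
    (continuous_choiceProb j).comp (Continuous.prodMk_right G))

theorem integrable_choiceProb_smul_iff (G : Mix d) (M : Measure (Cov J d))
    (f : Fin J × Cov J d → ℝ) :
    Integrable f (obsLaw G M) ↔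
      Integrable (fun z => choiceProb G z.2 z.1 * f z) (Measure.count.prod M) := by
  rw [obsLaw, integrable_withDensity_iff_integrable_smul' (measurable_choiceProb G).ennreal_ofReal
    (Eventually.of_forall fun _ => ENNReal.ofReal_lt_top)]
  simp_rw [ENNReal.toReal_ofReal (choiceProb_nonneg _ _ _), smul_eq_mul]

theorem integral_obsLaw (G : Mix d) (M : Measure (Cov J d)) [SFinite M]
    {f : Fin J × Cov J d → ℝ} (hf : Integrable f (obsLaw G M)) :
    ∫ z, f z ∂(obsLaw G M) = ∫ x, ∑ j, choiceProb G x j * f (j, x) ∂M := by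
  have hf' := (integrable_choiceProb_smul_iff G M f).1 hf
  rw [obsLaw, integral_withDensity_eq_integral_toReal_smul
    (measurable_choiceProb G).ennreal_ofReal (Eventually.of_forall fun _ => ENNReal.ofReal_lt_top)]
  simp_rw [ENNReal.toReal_ofReal (choiceProb_nonneg _ _ _), smul_eq_mul]
  rw [integral_prod_symm _ hf']
  refine integral_congr_ae (Eventually.of_forall fun x => ?_)
  simp only
  rw [integral_fintype .of_finite]
  simp [Measure.real]

/-- The covariate has marginal law `M`. -/
theorem map_snd_obsLaw [NeZero J] (G : Mix d) (M : Measure (Cov J d)) [SFinite M] :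
    (obsLaw G M).map Prod.snd = M := by
  ext B hB
  have h1 : ∀ x : Cov J d, ∑ j : Fin J, ENNReal.ofReal (choiceProb G x j) = 1 := fun x => by
    rw [← ENNReal.ofReal_sum_of_nonneg fun j _ => choiceProb_nonneg G x j, sum_choiceProb,
      ENNReal.ofReal_one]
  rw [Measure.map_apply measurable_snd hB, obsLaw, withDensity_apply _ (measurable_snd hB),
    ← lintegral_indicator (measurable_snd hB), lintegral_prod_symm' _
      ((measurable_choiceProb G).ennreal_ofReal.indicator (measurable_snd hB)),
    ← lintegral_indicator_one hB]
  refine lintegral_congr fun x => ?_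
  by_cases hx : x ∈ B <;> simp [Set.indicator, hx, lintegral_count, tsum_fintype, h1]

theorem ae_snd_mem_obsLaw [NeZero J] (G : Mix d) {M : Measure (Cov J d)} [SFinite M]
    {𝒳 : Set (Cov J d)} (hM : M 𝒳ᶜ = 0) : ∀ᵐ z ∂(obsLaw G M), z.2 ∈ 𝒳 := by
  have : ∀ᵐ x ∂((obsLaw G M).map Prod.snd), x ∈ 𝒳 := by rw [map_snd_obsLaw]; exact hM
  exact ae_of_ae_map measurable_snd.aemeasurable this

theorem div_mem_Icc {c u p : ℝ} (hc0 : 0 < c) (hp : c ≤ p) (hu : u ∈ Set.Icc (0 : ℝ) 1) :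
    0 ≤ u / p ∧ u / p ≤ c⁻¹ :=
  ⟨div_nonneg hu.1 (hc0.le.trans hp), by
    rw [div_eq_mul_inv, ← one_mul c⁻¹]
    exact mul_le_mul hu.2 (inv_anti₀ hc0 hp) (inv_nonneg.2 (hc0.le.trans hp)) zero_le_one⟩

theorem choiceDist_sq_le_integral {M : Measure (Cov J d)} [IsProbabilityMeasure M] {𝒳 : Set (Cov J d)}
    (hM : M 𝒳ᶜ = 0) (G G₀ : Mix d) :
    choiceDist M 𝒳 (choiceVec G) (choiceVec G₀) ^ 2 ≤
        ∫ x, ‖choiceVec G x - choiceVec G₀ x‖ ^ 2 ∂M ∧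
      Integrable (fun x => ‖choiceVec G x - choiceVec G₀ x‖ ^ 2) M := by
  have hsq : ∀ x : Cov J d, ‖choiceVec G x - choiceVec G₀ x‖ ^ 2 =
      ∑ j, (choiceProb G x j - choiceProb G₀ x j) ^ 2 := fun x => by
    simp [EuclideanSpace.norm_sq_eq, choiceVec]
  have hcont : Continuous fun x => ‖choiceVec (J := J) G x - choiceVec G₀ x‖ :=
    ((continuous_choiceVec G).sub (continuous_choiceVec G₀)).norm
  have hint2 : Integrable (fun x : Cov J d => ‖choiceVec G x - choiceVec G₀ x‖ ^ 2) M := by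
    refine Integrable.of_bound (hcont.pow 2).aestronglyMeasurable J
      (Eventually.of_forall fun x => ?_)
    rw [Real.norm_of_nonneg (by positivity), hsq]
    calc ∑ j, (choiceProb G x j - choiceProb G₀ x j) ^ 2 ≤ ∑ _ : Fin J, (1 : ℝ) :=
          Finset.sum_le_sum fun j _ => by
            obtain ⟨h1, h2⟩ := choiceProb_mem_Icc G x j
            obtain ⟨h3, h4⟩ := choiceProb_mem_Icc G₀ x j
            rw [sq_le_one_iff_abs_le_one, abs_le]
            constructor <;> linarith
      _ = J := by simp
  have hdist : choiceDist M 𝒳 (choiceVec G) (choiceVec G₀) =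
      ∫ x, ‖choiceVec G x - choiceVec G₀ x‖ ∂M := by
    rw [choiceDist, Measure.restrict_eq_self_of_ae_mem (show ∀ᵐ x ∂M, x ∈ 𝒳 from hM)]
  have hint1 : Integrable (fun x : Cov J d => ‖choiceVec G x - choiceVec G₀ x‖) M := by
    refine (hint2.add (integrable_const 1)).mono' hcont.aestronglyMeasurable
      (Eventually.of_forall fun x => ?_)
    simp only [norm_norm, Pi.add_apply]
    nlinarith [sq_nonneg (‖choiceVec G x - choiceVec G₀ x‖ - 1)]
  refine ⟨?_, hint2⟩
  rw [hdist]
  -- Jensen's inequality, from `2 D y - D² ≤ y²`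
  set D := ∫ x, ‖choiceVec G x - choiceVec G₀ x‖ ∂M with hD
  have hmono : ∫ x, (2 * D * ‖choiceVec G x - choiceVec G₀ x‖ - D ^ 2) ∂M ≤
      ∫ x, ‖choiceVec G x - choiceVec G₀ x‖ ^ 2 ∂M :=
    integral_mono ((hint1.const_mul _).sub (integrable_const _)) hint2 fun x => by
      simp only
      nlinarith [sq_nonneg (‖choiceVec G x - choiceVec G₀ x‖ - D)]
  rw [integral_sub (hint1.const_mul _) (integrable_const _), integral_const_mul, ← hD] at hmono
  simp only [integral_const, probReal_univ, one_smul] at hmono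
  linarith

section Scores

variable [NeZero J] {G₀ : Mix d} {M : Measure (Cov J d)} [IsProbabilityMeasure M]
  {𝒳 : Set (Cov J d)} {c : ℝ}

theorem integrable_chiScore_div (hM : M 𝒳ᶜ = 0) (hc0 : 0 < c) (hc1 : c ≤ 1)
    (hc : ∀ (j : Fin J), ∀ x ∈ 𝒳, c ≤ choiceProb G₀ x j) {u : Fin J × Cov J d → ℝ}
    (hu : Measurable u) (hu01 : ∀ z, u z ∈ Set.Icc (0 : ℝ) 1) :
    Integrable (fun z => chiScore c (u z / choiceProb G₀ z.2 z.1)) (obsLaw G₀ M) := by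
  refine Integrable.of_bound
    ((measurable_chiScore c).comp (hu.div (measurable_choiceProb G₀))).aestronglyMeasurable
    (2 * (c⁻¹ + 1)) ?_
  filter_upwards [ae_snd_mem_obsLaw G₀ hM] with z hz
  obtain ⟨h0, h1⟩ := div_mem_Icc hc0 (hc z.1 z.2 hz) (hu01 z)
  have hone : chiScore c 1 = 0 := by simp [chiScore]
  have := abs_chiScore_sub_le hc0 hc1 h0 h1 zero_le_one (one_le_inv_iff₀.2 ⟨hc0, hc1⟩)
  rw [hone, sub_zero] at this
  rw [Real.norm_eq_abs]
  refine this.trans (mul_le_mul_of_nonneg_left (abs_le.2 ⟨?_, ?_⟩) two_pos.le) <;>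
    linarith [inv_pos.2 hc0]

/-- The mean score under `G₀`: the linear part has mean `∑ j, (q_j(x; G) - q_j(x; G₀)) = 0`, and the
quadratic part is at most `-(c/4) ‖q(x; G) - q(x; G₀)‖²` because `q_j(x; G₀) ≤ 1`. -/
theorem integral_chiScore_le (hM : M 𝒳ᶜ = 0) (hc0 : 0 < c) (hc1 : c ≤ 1)
    (hc : ∀ (j : Fin J), ∀ x ∈ 𝒳, c ≤ choiceProb G₀ x j) (G : Mix d) :
    ∫ z, chiScore c (choiceProb G z.2 z.1 / choiceProb G₀ z.2 z.1) ∂(obsLaw G₀ M) ≤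
      -(c / 4 * choiceDist M 𝒳 (choiceVec G) (choiceVec G₀) ^ 2) := by
  have hint := integrable_chiScore_div hM hc0 hc1 hc (measurable_choiceProb (J := J) G)
    fun z => choiceProb_mem_Icc G z.2 z.1
  obtain ⟨hle, hint2⟩ := choiceDist_sq_le_integral hM G G₀
  rw [integral_obsLaw G₀ M hint]
  have hpt : ∀ x ∈ 𝒳, ∑ j, choiceProb G₀ x j *
      chiScore c (choiceProb G x j / choiceProb G₀ x j) ≤
        -(c / 4 * ‖choiceVec G x - choiceVec G₀ x‖ ^ 2) := fun x hx => by
    have hj : ∀ j, choiceProb G₀ x j * chiScore c (choiceProb G x j / choiceProb G₀ x j) ≤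
        (choiceProb G x j - choiceProb G₀ x j)
          - c / 4 * (choiceProb G x j - choiceProb G₀ x j) ^ 2 := fun j => by
      have hp : 0 < choiceProb G₀ x j := hc0.trans_le (hc j x hx)
      have heq : choiceProb G₀ x j * chiScore c (choiceProb G x j / choiceProb G₀ x j) =
          (choiceProb G x j - choiceProb G₀ x j)
            - c / 4 * ((choiceProb G x j - choiceProb G₀ x j) ^ 2 / choiceProb G₀ x j) := by
        unfold chiScore; field_simp
      rw [heq]
      have : (choiceProb G x j - choiceProb G₀ x j) ^ 2 ≤
          (choiceProb G x j - choiceProb G₀ x j) ^ 2 / choiceProb G₀ x j :=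
        le_div_self (sq_nonneg _) hp (choiceProb_le_one G₀ x j)
      gcongr
    refine (Finset.sum_le_sum fun j _ => hj j).trans_eq ?_
    rw [Finset.sum_sub_distrib, Finset.sum_sub_distrib, sum_choiceProb, sum_choiceProb,
      ← Finset.mul_sum, EuclideanSpace.norm_sq_eq]
    simp [choiceVec]
  have hleft : Integrable (fun x => ∑ j, choiceProb G₀ x j *
      chiScore c (choiceProb G x j / choiceProb G₀ x j)) M := by
    refine (((integrable_choiceProb_smul_iff G₀ M _).1 hint).integral_prod_right).congr
      (Eventually.of_forall fun x => ?_)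
    simp only
    rw [integral_fintype .of_finite]
    simp [Measure.real]
  calc _ ≤ ∫ x, -(c / 4 * ‖choiceVec G x - choiceVec G₀ x‖ ^ 2) ∂M :=
        integral_mono_ae hleft (hint2.const_mul _).neg
          ((show ∀ᵐ x ∂M, x ∈ 𝒳 from hM).mono hpt)
    _ ≤ _ := by
        rw [integral_neg, integral_const_mul]
        gcongr

/-- Almost surely, the likelihood ratio is eventually bounded in terms of the distance to `G₀`,
simultaneously for all mixing distributions. -/
theorem ae_eventually_likelihoodRatio_le (hM : M 𝒳ᶜ = 0) (hc0 : 0 < c) (hc1 : c ≤ 1)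
    (hc : ∀ (j : Fin J), ∀ x ∈ 𝒳, c ≤ choiceProb G₀ x j) {δ : ℝ} (hδ : 0 < δ) :
    ∀ᵐ ω ∂(dataLaw G₀ M), ∀ᶠ n : ℕ in atTop, ∀ G : Mix d, likelihoodRatio G₀ n ω G ≤
      Real.exp (n * (-(c / 4 * choiceDist M 𝒳 (choiceVec G) (choiceVec G₀) ^ 2) + δ)) := by
  have hZ := ae_snd_mem_obsLaw (M := M) G₀ hM
  have hulln := uniform_strong_law_infinitePi (obsLaw G₀ M) (Z₀ := {z | z.2 ∈ 𝒳}) hZ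
    (fun (G : Mix d) z => chiScore c (choiceProb G z.2 z.1 / choiceProb G₀ z.2 z.1))
    (fun G => integrable_chiScore_div hM hc0 hc1 hc (measurable_choiceProb (J := J) G)
      fun z => choiceProb_mem_Icc G z.2 z.1)
    (fun δ hδ => by
      -- `t` is `1/c`-Lipschitz in `q_j(x; G)`, and the score `2`-Lipschitz in `t`
      obtain ⟨K, m, h, o, hh, ho, happ⟩ := exists_finite_net_choiceProb M
        (show 0 < c / 2 * δ by positivity)
      have hhm : ∀ k, Measurable fun z : Fin J × Cov J d => h k z.2 z.1 := fun k =>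
        measurable_from_prod_countable_right fun j => (hh k j).1
      refine ⟨K, m, fun k z => chiScore c (h k z.2 z.1 / choiceProb G₀ z.2 z.1),
        fun i z => 2 / c * o i z.2, fun k => ⟨?_, ?_⟩, fun i => ⟨?_, ?_, ?_⟩, fun G => ?_⟩
      · exact (measurable_chiScore c).comp ((hhm k).div (measurable_choiceProb G₀))
      · exact integrable_chiScore_div hM hc0 hc1 hc (hhm k) fun z => (hh k z.1).2 z.2
      · exact ((ho i).1.comp measurable_snd).const_mul _
      · refine Integrable.const_mul (Integrable.comp_measurable ?_ measurable_snd) _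
        rw [map_snd_obsLaw]; exact (ho i).2.1
      · have hmap : ∫ z, o i z.2 ∂(obsLaw G₀ M) = ∫ x, o i x ∂M := by
          conv_rhs => rw [← map_snd_obsLaw G₀ M]
          exact (integral_map measurable_snd.aemeasurable
            (ho i).1.aestronglyMeasurable).symm
        rw [integral_const_mul, hmap]
        calc 2 / c * ∫ x, o i x ∂M ≤ 2 / c * (c / 2 * δ) := by gcongr; exact (ho i).2.2
          _ = δ := by field_simp
      · obtain ⟨k, g, hg, hGk⟩ := happ G
        refine ⟨k, g, hg, fun z hz => ?_⟩
        have hp := hc z.1 z.2 hz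
        obtain ⟨h0, h1⟩ := div_mem_Icc hc0 hp (choiceProb_mem_Icc G z.2 z.1)
        obtain ⟨h0', h1'⟩ := div_mem_Icc hc0 hp ((hh k z.1).2 z.2)
        refine (abs_chiScore_sub_le hc0 hc1 h0 h1 h0' h1').trans ?_
        rw [← sub_div, abs_div, abs_of_pos (hc0.trans_le hp)]
        calc 2 * (|choiceProb G z.2 z.1 - h k z.2 z.1| / choiceProb G₀ z.2 z.1)
            ≤ 2 * ((c / 2 * δ + ∑ i, g i * o i z.2) / c) := by
              refine mul_le_mul_of_nonneg_left (div_le_div₀ ?_ (hGk _ _) hc0 hp) two_pos.le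
              exact (abs_nonneg _).trans (hGk z.2 z.1)
          _ = δ + ∑ i, g i * (2 / c * o i z.2) := by
              simp_rw [mul_left_comm (g _), ← Finset.mul_sum]
              field_simp) hδ
  filter_upwards [hulln, ae_forall_infinitePi _ hZ] with ω hω hω𝒳
  filter_upwards [hω] with n hn G
  calc likelihoodRatio G₀ n ω G
      ≤ ∏ t ∈ Finset.range n, Real.exp (chiScore c
          (choiceProb G (ω t).2 (ω t).1 / choiceProb G₀ (ω t).2 (ω t).1)) := by
        refine Finset.prod_le_prod (fun t _ => div_nonneg (choiceProb_nonneg _ _ _)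
          (choiceProb_nonneg _ _ _)) fun t _ => ?_
        obtain ⟨h0, h1⟩ := div_mem_Icc hc0 (hc (ω t).1 (ω t).2 (hω𝒳 t))
          (choiceProb_mem_Icc G (ω t).2 (ω t).1)
        exact le_exp_chiScore hc0 hc1 h0 h1
    _ = Real.exp (∑ t ∈ Finset.range n, chiScore c
          (choiceProb G (ω t).2 (ω t).1 / choiceProb G₀ (ω t).2 (ω t).1)) :=
        (Real.exp_sum _ _).symm
    _ ≤ _ := by
        refine Real.exp_le_exp.2 ((hn G).trans ?_)
        gcongr
        exact integral_chiScore_le hM hc0 hc1 hc G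

end Scores

theorem exp_neg_le_likelihoodRatio {G₀ G : Mix d} {𝒳 : Set (Cov J d)}
    (hpos : ∀ (j : Fin J), ∀ x ∈ 𝒳, 0 < choiceProb G₀ x j)
    {η : ℝ} (hG : ∀ x ∈ 𝒳, ∀ j, Real.exp (-η) * choiceProb G₀ x j ≤ choiceProb G x j)
    {ω : ℕ → Fin J × Cov J d} (hω : ∀ t, (ω t).2 ∈ 𝒳) (n : ℕ) :
    Real.exp (-(n * η)) ≤ likelihoodRatio G₀ n ω G := by
  calc Real.exp (-(n * η)) = ∏ _t ∈ Finset.range n, Real.exp (-η) := by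
        rw [Finset.prod_const, Finset.card_range, ← Real.exp_nat_mul]; ring_nf
    _ ≤ likelihoodRatio G₀ n ω G :=
        Finset.prod_le_prod (fun _ _ => (Real.exp_pos _).le) fun t _ =>
          (le_div_iff₀ (hpos _ _ (hω t))).2 (hG _ (hω t) _)

/-- If `Λ_n ≤ exp (-2nη)` on `A` and `Λ_n ≥ exp (-nη)` on `V`, then the posterior mass of `A` is
small. Neither set has to be measurable. -/
theorem posterior_le (Pi : Measure (Mix d)) [IsProbabilityMeasure Pi] {G₀ : Mix d} {n : ℕ}
    {ω : ℕ → Fin J × Cov J d} {A V : Set (Mix d)} {η : ℝ}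
    (hA : ∀ G ∈ A, likelihoodRatio G₀ n ω G ≤ Real.exp (-(n * (2 * η))))
    (hV : ∀ G ∈ V, Real.exp (-(n * η)) ≤ likelihoodRatio G₀ n ω G) :
    posterior Pi G₀ n ω A ≤ (Pi V)⁻¹ * ENNReal.ofReal (Real.exp (-(n * η))) := by
  set r := ENNReal.ofReal (Real.exp (-(n * η))) with hr
  have hr0 : r ≠ 0 := (ENNReal.ofReal_pos.2 (Real.exp_pos _)).ne'
  have hden : r * Pi V ≤ ∫⁻ G, ENNReal.ofReal (likelihoodRatio G₀ n ω G) ∂Pi :=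
    le_trans (mul_le_mul_right (measure_mono fun G hG => ENNReal.ofReal_le_ofReal (hV G hG)) r)
      (mul_meas_ge_le_lintegral (measurable_likelihoodRatio G₀ n ω).ennreal_ofReal r)
  have hnum : ∫⁻ G in A, ENNReal.ofReal (likelihoodRatio G₀ n ω G) ∂Pi ≤ r * r := by
    calc ∫⁻ G in A, ENNReal.ofReal (likelihoodRatio G₀ n ω G) ∂Pi ≤ ∫⁻ _ in A, r * r ∂Pi := by
          refine setLIntegral_mono measurable_const fun G hG => ?_
          rw [hr, ← ENNReal.ofReal_mul (Real.exp_pos _).le, ← Real.exp_add]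
          refine ENNReal.ofReal_le_ofReal ((hA G hG).trans_eq ?_)
          ring_nf
      _ = r * r * Pi A := by simp
      _ ≤ r * r := mul_le_of_le_one_right' prob_le_one
  rw [posterior, Measure.smul_apply, smul_eq_mul, withDensity_apply']
  calc _ ≤ (r * Pi V)⁻¹ * (r * r) := mul_le_mul' (ENNReal.inv_le_inv.2 hden) hnum
    _ = (Pi V)⁻¹ * r * (r⁻¹ * r) := by
        rw [ENNReal.mul_inv (Or.inl hr0) (Or.inl ENNReal.ofReal_ne_top)]; ring
    _ = (Pi V)⁻¹ * r := by rw [ENNReal.inv_mul_cancel hr0 ENNReal.ofReal_ne_top, mul_one]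

end MMNL

theorem theorem1 {J d : ℕ} [NeZero J]
    (𝒳 : Set (MMNL.Cov J d)) (h𝒳 : IsCompact 𝒳)
    (M : Measure (MMNL.Cov J d)) [IsProbabilityMeasure M] (hM : M 𝒳ᶜ = 0)
    (Pi : Measure (MMNL.Mix d)) [IsProbabilityMeasure Pi]
    (G₀ : MMNL.Mix d) (hG₀ : G₀ ∈ Pi.support)
    (h_i : ∀ (j : Fin J), ∀ x ∈ 𝒳, 0 < MMNL.choiceProb G₀ x j)
    (h_ii : ∫⁻ β, ‖β‖ₑ ∂(MMNL.priorPredictive Pi) < ∞) :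
    MMNL.IsConsistentAt Pi G₀ M 𝒳 := by
  intro ε hε
  obtain ⟨c, hc0, hc1, hc⟩ := MMNL.exists_forall_le_choiceProb h𝒳 h_i
  -- `d > ε` gives mean score below `-4η`; `2η` is lost in the uniform law, `η` in the denominator
  obtain ⟨η, hη, hηε⟩ : ∃ η : ℝ, 0 < η ∧ 4 * η = c / 4 * ε ^ 2 :=
    ⟨c / 16 * ε ^ 2, by positivity, by ring⟩
  set V : Set (MMNL.Mix d) := {G | ∀ x ∈ 𝒳, ∀ j,
    Real.exp (-η) * MMNL.choiceProb G₀ x j ≤ MMNL.choiceProb G x j}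
  have hPiV : 0 < Pi V := (Measure.mem_support_iff_forall G₀).1 hG₀ V
    (MMNL.eventually_exp_neg_mul_choiceProb_le h𝒳 h_i hη)
  have hlim : Tendsto (fun n : ℕ => (Pi V)⁻¹ * ENNReal.ofReal (Real.exp (-(n * η)))) atTop
      (𝓝 0) := by
    have hexp : Tendsto (fun n : ℕ => ENNReal.ofReal (Real.exp (-(n * η)))) atTop (𝓝 0) := by
      rw [← ENNReal.ofReal_zero]
      exact ENNReal.tendsto_ofReal (Real.tendsto_exp_neg_atTop_nhds_zero.comp
        (tendsto_natCast_atTop_atTop.atTop_mul_const hη))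
    simpa using ENNReal.Tendsto.const_mul hexp (Or.inr (ENNReal.inv_ne_top.2 hPiV.ne'))
  filter_upwards [MMNL.ae_eventually_likelihoodRatio_le hM hc0 hc1 hc
      (show 0 < 2 * η by positivity),
    MMNL.ae_forall_infinitePi _ (MMNL.ae_snd_mem_obsLaw G₀ hM)] with ω hω hω𝒳
  refine tendsto_of_tendsto_of_tendsto_of_le_of_le' tendsto_const_nhds hlim
    (Eventually.of_forall fun _ => zero_le) ?_
  filter_upwards [hω] with n hn
  refine MMNL.posterior_le Pi (fun G hG => (hn G).trans (Real.exp_le_exp.2 ?_))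
    fun G hG => MMNL.exp_neg_le_likelihoodRatio h_i hG hω𝒳 n
  have hsq : ε ^ 2 ≤ MMNL.choiceDist M 𝒳 (MMNL.choiceVec G) (MMNL.choiceVec G₀) ^ 2 := by
    have : ε < MMNL.choiceDist M 𝒳 (MMNL.choiceVec G) (MMNL.choiceVec G₀) := hG
    gcongr
  have hle : c / 4 * ε ^ 2 ≤
      c / 4 * MMNL.choiceDist M 𝒳 (MMNL.choiceVec G) (MMNL.choiceVec G₀) ^ 2 := by gcongr
  rw [← mul_neg (n : ℝ)]
  exact mul_le_mul_of_nonneg_left (by linarith) n.cast_nonneg
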